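/- Let $\mathsf{PRA}$ be primitive recursive arithmetic, formulated in classical first-order logic with equality, with a function symbol for every (description of a) primitive recursive function and the relation symbol $<$; its axioms are $Sx\neq 0$, $Sx=Sy\to x=y$, the defining equations of all primitive recursive functions, the defining axioms $\neg\, x<0$ and $x<Sy\leftrightarrow(x<y\lor x=y)$ of $<$, and induction for quantifier-free formulas. Let $\Delta_0$ be the class of primitive recursive formulas, i.e. the formulas of this language built from atomic formulas by propositional connectives and bounded quantifiers. For a formula $x\prec y$ let $\mathrm{TI}(\prec;\Delta_0)$ be the schema (with parameters) $$\forall x\,\bigl(\forall y\,(y\prec x\to\varphi(y))\to\varphi(x)\bigr)\to\forall x\,\varphi(x),\qquad \varphi\in\Delta_0 .$$ Let $\pi=\forall x\,\pi_0(x)$ be a $\Pi^0_1$ sentence, where $\pi_0(x)\in\Delta_0$ has no free variable other than $x$, and let $x\prec_\pi y$ be the formula $$(x<y\land\forall z<x\;\pi_0(z))\;\lor\;(y<x\land\exists z<y\;\neg\pi_0(z)).$$ Then for all $x,y\in\mathbb N$: if $\pi_0(z)$ holds for all $z<\min(x,y)$, then $x\prec_\pi y\iff x<y$; and if $\pi_0(z)$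 fails for some $z<\min(x,y)$, then $x\prec_\pi y\iff y<x$. If moreover $\pi$ is true (in the standard model), then $x\prec_\pi y$ is a $\Delta_0$ formula that defines a primitive recursive well-ordering of $\mathbb N$ of order type $\omega$, and $$\mathsf{PRA}+\mathrm{TI}(\prec_\pi;\Delta_0)\vdash\pi .$$ -/

import Mathlib

open FirstOrder FirstOrder.Language

namespace Kreisel

/-! ### The language of primitive recursive arithmetic -/

/-- Descriptions of `n`-ary primitive recursive functions. -/
inductive PRFun : ℕ → Type
  /-- the constant `0` -/
  | zero : PRFun 0
  /-- the successor function -/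
  | succ : PRFun 1
  /-- the projection `(x₀, …, xₙ₋₁) ↦ xᵢ` -/
  | proj {n : ℕ} (i : Fin n) : PRFun n
  /-- the composition `x⃗ ↦ f (g₀ x⃗, …, gₘ₋₁ x⃗)` -/
  | comp {m n : ℕ} (f : PRFun m) (g : Fin m → PRFun n) : PRFun n
  /-- primitive recursion `h (0, x⃗) = f x⃗`, `h (y + 1, x⃗) = g (y, h (y, x⃗), x⃗)` -/
  | prec {n : ℕ} (f : PRFun n) (g : PRFun (n + 2)) : PRFun (n + 1)

/-- The function on the natural numbers that is described by an element of `PRFun n`. -/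
def PRFun.eval : {n : ℕ} → PRFun n → (Fin n → ℕ) → ℕ
  | _, .zero, _ => 0
  | _, .succ, v => v 0 + 1
  | _, .proj i, v => v i
  | _, .comp f g, v => f.eval fun i => (g i).eval v
  | _, .prec f g, v =>
      Nat.rec (f.eval (Fin.tail v))
        (fun y r => g.eval (Fin.cons y (Fin.cons r (Fin.tail v)))) (v 0)

/-- The relation symbols besides equality: only the binary symbol `<`. -/
inductive PRRel : ℕ → Type
  | lt : PRRel 2

/-- The language of `PRA`: a function symbol for each description of a primitive recursive
function, and the relation symbol `<`. -/
def PRLang : Language := ⟨PRFun, PRRel⟩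

/-- The standard model. -/
instance : PRLang.Structure ℕ where
  funMap := fun f v => PRFun.eval f v
  RelMap := fun {_} r => match r with
    | PRRel.lt => fun v => v 0 < v 1

/-- Terms in the variables `x₀, …, xₙ₋₁`. -/
abbrev Tm (n : ℕ) := PRLang.Term (Empty ⊕ Fin n)

/-- Formulas whose free variables are among `x₀, …, xₙ₋₁`; a quantifier in front of a
`Fml (n + 1)` binds `xₙ`. -/
abbrev Fml (n : ℕ) := PRLang.BoundedFormula Empty n

/-- The variable `xᵢ` as a term. -/
def vr {n : ℕ} (i : Fin n) : Tm n := Term.var (Sum.inr i)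

/-- The term `f(t₀, …, tₖ₋₁)`. -/
def fn {n k : ℕ} (f : PRFun k) (ts : Fin k → Tm n) : Tm n :=
  Term.func (L := PRLang) f ts

/-- The constant term `0`. -/
def zeroT {n : ℕ} : Tm n := fn .zero ![]

/-- The term `S t`. -/
def succT {n : ℕ} (t : Tm n) : Tm n := fn .succ ![t]

/-- The atomic formula `s < t`. -/
def ltF {n : ℕ} (s t : Tm n) : Fml n :=
  BoundedFormula.rel (L := PRLang) PRRel.lt ![s, t]

/-! ### Substitution -/

/-- Simultaneous substitution `t(s₀, …, sₙ₋₁)` in a term. -/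
def substT {n m : ℕ} (t : Tm n) (s : Fin n → Tm m) : Tm m :=
  t.subst (Sum.elim (fun e => e.elim) s)

/-- A term in `x₀, …, xₙ₋₁` viewed as a term in `x₀, …, xₙ`. -/
def liftT {n : ℕ} (t : Tm n) : Tm (n + 1) := substT t fun i => vr i.castSucc

/-- Simultaneous capture-avoiding substitution `φ(s₀, …, sₙ₋₁)` in a formula. -/
def substF : {n m : ℕ} → Fml n → (Fin n → Tm m) → Fml m
  | _, _, .falsum, _ => .falsum
  | _, _, .equal t u, s => .equal (substT t s) (substT u s)
  | _, _, .rel R ts, s => .rel R fun i => substT (ts i) s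
  | _, _, .imp φ ψ, s => .imp (substF φ s) (substF ψ s)
  | _, m, .all φ, s =>
      .all (substF φ (Fin.snoc (α := fun _ => Tm (m + 1)) (fun i => liftT (s i))
        (vr (Fin.last m))))

/-- A formula in `x₀, …, xₙ₋₁` viewed as a formula in `x₀, …, xₙ`. -/
def liftF {n : ℕ} (φ : Fml n) : Fml (n + 1) := substF φ fun i => vr i.castSucc

/-- A sentence viewed as a formula in `x₀, …, xₙ₋₁`. -/
def liftS {n : ℕ} (σ : PRLang.Sentence) : Fml n := substF (n := 0) σ Fin.elim0

/-- `φ(x₀, …, xₙ₋₁, t)`: the term `t` is substituted for the last variable `xₙ` of `φ`. -/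
def inst {n : ℕ} (φ : Fml (n + 1)) (t : Tm n) : Fml n :=
  substF φ (Fin.snoc (α := fun _ => Tm n) vr t)

/-! ### Bounded quantifiers and `Δ₀` formulas -/

/-- `∀ xₙ < t, φ`, where `xₙ` does not occur in `t`. -/
def ball {n : ℕ} (t : Tm n) (φ : Fml (n + 1)) : Fml n :=
  ∀' (ltF (vr (Fin.last n)) (liftT t) ⟹ φ)

/-- `∃ xₙ < t, φ`, where `xₙ` does not occur in `t`. -/
def bex {n : ℕ} (t : Tm n) (φ : Fml (n + 1)) : Fml n :=
  ∃' (ltF (vr (Fin.last n)) (liftT t) ⊓ φ)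

/-- The primitive recursive (`Δ₀`) formulas: the formulas of the language of `PRA` that are built
from atomic formulas by propositional connectives and bounded quantifiers. (The connectives
`∼`, `⊓`, `⊔` are abbreviations in terms of `falsum` and `imp`.) -/
inductive IsDelta0 : {n : ℕ} → Fml n → Prop
  | falsum {n : ℕ} : IsDelta0 (BoundedFormula.falsum : Fml n)
  | equal {n : ℕ} (s t : Tm n) : IsDelta0 (BoundedFormula.equal s t : Fml n)
  | lt {n : ℕ} (s t : Tm n) : IsDelta0 (ltF s t)
  | imp {n : ℕ} {φ ψ : Fml n} : IsDelta0 φ → IsDelta0 ψ → IsDelta0 (φ ⟹ ψ)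
  | ball {n : ℕ} (t : Tm n) {φ : Fml (n + 1)} : IsDelta0 φ → IsDelta0 (ball t φ)
  | bex {n : ℕ} (t : Tm n) {φ : Fml (n + 1)} : IsDelta0 φ → IsDelta0 (bex t φ)

/-! ### Provability in classical first-order logic with equality -/

/-- Natural deduction for classical first-order logic with equality. `Deriv T Γ φ` says that `φ`
is derivable from the axioms in `T` and the finitely many assumptions in `Γ`; the formulas in
`Γ` and `φ` may have the free variables `x₀, …, xₙ₋₁`. In the rule `allI` the eigenvariable
`xₙ` is not free in the assumptions. -/
inductive Deriv (T : PRLang.Theory) : {n : ℕ} → List (Fml n) → Fml n → Prop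
  | ax {n : ℕ} {Γ : List (Fml n)} {σ : PRLang.Sentence} : σ ∈ T → Deriv T Γ (liftS σ)
  | hyp {n : ℕ} {Γ : List (Fml n)} {φ : Fml n} : φ ∈ Γ → Deriv T Γ φ
  | impI {n : ℕ} {Γ : List (Fml n)} {φ ψ : Fml n} :
      Deriv T (φ :: Γ) ψ → Deriv T Γ (φ ⟹ ψ)
  | impE {n : ℕ} {Γ : List (Fml n)} {φ ψ : Fml n} :
      Deriv T Γ (φ ⟹ ψ) → Deriv T Γ φ → Deriv T Γ ψ
  | raa {n : ℕ} {Γ : List (Fml n)} {φ : Fml n} :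
      Deriv T (∼φ :: Γ) BoundedFormula.falsum → Deriv T Γ φ
  | allI {n : ℕ} {Γ : List (Fml n)} {φ : Fml (n + 1)} :
      Deriv T (Γ.map liftF) φ → Deriv T Γ (∀' φ)
  | allE {n : ℕ} {Γ : List (Fml n)} {φ : Fml (n + 1)} (t : Tm n) :
      Deriv T Γ (∀' φ) → Deriv T Γ (inst φ t)
  | eqI {n : ℕ} {Γ : List (Fml n)} (t : Tm n) : Deriv T Γ (BoundedFormula.equal t t)
  | eqE {n : ℕ} {Γ : List (Fml n)} {s t : Tm n} (φ : Fml (n + 1)) :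
      Deriv T Γ (BoundedFormula.equal s t) → Deriv T Γ (inst φ s) → Deriv T Γ (inst φ t)

/-- `T ⊢ σ` -/
def Proves (T : PRLang.Theory) (σ : PRLang.Sentence) : Prop := Deriv T (n := 0) [] σ

/-! ### Primitive recursive arithmetic and transfinite induction -/

/-- `φ(x₀, …, xₚ₋₁, 0) ⟹ ∀ x (φ(x₀, …, xₚ₋₁, x) ⟹ φ(x₀, …, xₚ₋₁, S x)) ⟹ ∀ x φ`,
universally closed. -/
def indAxiom {p : ℕ} (φ : Fml (p + 1)) : PRLang.Sentence :=
  (inst φ zeroT ⟹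
    (∀' (φ ⟹ substF φ
      (Fin.snoc (α := fun _ => Tm (p + 1)) (fun i => vr i.castSucc) (succT (vr (Fin.last p)))))) ⟹
    ∀' φ).alls

/-- The axioms of primitive recursive arithmetic. -/
inductive PRAAxiom : PRLang.Sentence → Prop
  /-- `S x ≠ 0` -/
  | succ_ne_zero : PRAAxiom (∀' ∼(BoundedFormula.equal (succT (vr (0 : Fin 1))) zeroT))
  /-- `S x = S y → x = y` -/
  | succ_inj : PRAAxiom
      (∀' ∀' (BoundedFormula.equal (succT (vr (0 : Fin 2))) (succT (vr 1)) ⟹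
        BoundedFormula.equal (vr 0) (vr 1)))
  /-- `projᵢ(x₀, …, xₙ₋₁) = xᵢ` -/
  | proj {n : ℕ} (i : Fin n) : PRAAxiom
      (BoundedFormula.equal (fn (.proj i) vr) (vr i) : Fml n).alls
  /-- `(comp f g)(x⃗) = f(g₀(x⃗), …, gₘ₋₁(x⃗))` -/
  | comp {m n : ℕ} (f : PRFun m) (g : Fin m → PRFun n) : PRAAxiom
      (BoundedFormula.equal (fn (.comp f g) vr) (fn f fun i => fn (g i) vr) : Fml n).alls
  /-- `(prec f g)(0, x⃗) = f(x⃗)` -/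
  | prec_zero {n : ℕ} (f : PRFun n) (g : PRFun (n + 2)) : PRAAxiom
      (BoundedFormula.equal
        (fn (.prec f g) (Fin.cons (α := fun _ => Tm n) zeroT vr)) (fn f vr) : Fml n).alls
  /-- `(prec f g)(S y, x⃗) = g(y, (prec f g)(y, x⃗), x⃗)`; here `y` is the variable `xₙ` -/
  | prec_succ {n : ℕ} (f : PRFun n) (g : PRFun (n + 2)) : PRAAxiom
      (BoundedFormula.equal
        (fn (.prec f g) (Fin.cons (α := fun _ => Tm (n + 1)) (succT (vr (Fin.last n)))
          fun i => vr i.castSucc))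
        (fn g (Fin.cons (α := fun _ => Tm (n + 1)) (vr (Fin.last n))
          (Fin.cons (α := fun _ => Tm (n + 1))
            (fn (.prec f g) (Fin.cons (α := fun _ => Tm (n + 1)) (vr (Fin.last n))
              fun i => vr i.castSucc))
            fun i => vr i.castSucc))) : Fml (n + 1)).alls
  /-- `¬ x < 0` -/
  | not_lt_zero : PRAAxiom (∀' ∼(ltF (vr (0 : Fin 1)) zeroT))
  /-- `x < S y ↔ x < y ∨ x = y` -/
  | lt_succ : PRAAxiom
      (∀' ∀' (ltF (vr (0 : Fin 2)) (succT (vr 1)) ⇔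
        (ltF (vr 0) (vr 1) ⊔ BoundedFormula.equal (vr 0) (vr 1))))
  /-- induction for quantifier-free formulas, with parameters -/
  | ind {p : ℕ} (φ : Fml (p + 1)) : φ.IsQF → PRAAxiom (indAxiom φ)

/-- Primitive recursive arithmetic. -/
def PRA : PRLang.Theory := {σ | PRAAxiom σ}

/-- `∀ x (∀ y (y ≺ x ⟹ φ(y)) ⟹ φ(x)) ⟹ ∀ x φ(x)`, universally closed. The parameters of `φ` are
`x₀, …, xₚ₋₁`, and `s ≺ t` is the formula `prec(s, t)`. -/
def tiAxiom (prec : Fml 2) {p : ℕ} (φ : Fml (p + 1)) : PRLang.Sentence :=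
  ((∀' ((∀' (substF prec ![vr (Fin.last (p + 1)), vr (Fin.last p).castSucc] ⟹
        substF φ (Fin.snoc (α := fun _ => Tm (p + 2)) (fun i => vr i.castSucc.castSucc)
          (vr (Fin.last (p + 1)))))) ⟹ φ)) ⟹
    ∀' φ).alls

/-- The schema `TI(≺; Δ₀)` of transfinite induction along `≺` for `Δ₀` formulas. -/
def TI (prec : Fml 2) : PRLang.Theory :=
  {σ | ∃ (p : ℕ) (φ : Fml (p + 1)), IsDelta0 φ ∧ σ = tiAxiom prec φ}

/-! ### Kreisel's ordering -/

/-- The formula `x ≺ y` given by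
`(x < y ∧ ∀ z < x, π₀(z)) ∨ (y < x ∧ ∃ z < y, ¬ π₀(z))`, with `x = x₀` and `y = x₁`. -/
def kreiselOrder (π₀ : Fml 1) : Fml 2 :=
  (ltF (vr 0) (vr 1) ⊓ ball (vr 0) (substF π₀ ![vr 2])) ⊔
    (ltF (vr 1) (vr 0) ⊓ bex (vr 1) ∼(substF π₀ ![vr 2]))

/-- The set of natural numbers that a formula with one free variable defines in the standard
model. -/
def Holds (φ : Fml 1) (x : ℕ) : Prop := φ.Realize default ![x]

/-- The binary relation on the natural numbers that a formula with two free variables defines in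
the standard model. -/
def relOf (φ : Fml 2) (x y : ℕ) : Prop := φ.Realize default ![x, y]

end Kreisel

namespace Kreisel

/-! ### Substitution -/

/-! The order `≺` is `<` up to the first counterexample to `π₀` and is reversed beyond it. If there
is no counterexample, `≺` is literally `<`, hence primitive recursive of type `ω`. For provability,
let `φ(x)` be `∀ z < x, π₀(z)`. It is progressive: if `φ(x)` fails, the second disjunct of `≺` gives
`S x ≺ x` (`Deriv.succ_prec`), so the induction hypothesis yields `φ(S x)`, which implies `φ(x)`, a
contradiction. Transfinite induction gives `∀ x φ(x)`, and `φ(S x)` contains `π₀(x)`. Only the axiom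
for `x < S y` is used from `PRA`, and the truth of `π` plays no role in the derivation. The
remaining work is substitution calculus. -/

theorem substT_vr {n m : ℕ} (i : Fin n) (s : Fin n → Tm m) : substT (vr i) s = s i := rfl

theorem substT_substT {n m k : ℕ} (t : Tm n) (s : Fin n → Tm m) (r : Fin m → Tm k) :
    substT (substT t s) r = substT t fun i => substT (s i) r := by
  induction t with
  | var v => rcases v with e | i <;> [exact e.elim; rfl]
  | func f ts ih => exact congrArg (Term.func f) (funext ih)

theorem substT_id {n : ℕ} (t : Tm n) : substT t vr = t := by
  induction t with
  | var v => rcases v with e | i <;> [exact e.elim; rfl]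
  | func f ts ih => exact congrArg (Term.func f) (funext ih)

/-- The substitution `s` extended to one more, bound, variable. -/
def up {n m : ℕ} (s : Fin n → Tm m) : Fin (n + 1) → Tm (m + 1) :=
  Fin.snoc (α := fun _ => Tm (m + 1)) (fun i => liftT (s i)) (vr (Fin.last m))

theorem up_castSucc {n m : ℕ} (s : Fin n → Tm m) (i : Fin n) :
    up s i.castSucc = liftT (s i) := by
  simp [up]

theorem up_last {n m : ℕ} (s : Fin n → Tm m) : up s (Fin.last n) = vr (Fin.last m) := by
  simp [up]

theorem substT_liftT {n m : ℕ} (t : Tm n) (s : Fin (n + 1) → Tm m) :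
    substT (liftT t) s = substT t fun i => s i.castSucc :=
  substT_substT _ _ _

theorem substT_liftT_up {n m : ℕ} (t : Tm n) (s : Fin n → Tm m) :
    substT (liftT t) (up s) = liftT (substT t s) := by
  simp only [substT_liftT, up_castSucc]
  exact (substT_substT _ _ _).symm

theorem substT_up_up {n m k : ℕ} (s : Fin n → Tm m) (r : Fin m → Tm k) :
    (fun i => substT (up s i) (up r)) = up fun i => substT (s i) r := by
  funext i
  refine Fin.lastCases ?_ (fun i => ?_) i
  · simp only [up_last, substT_vr]
  · simp only [up_castSucc, substT_liftT_up]

theorem up_vr {n : ℕ} : up (vr : Fin n → Tm n) = vr := by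
  funext i
  refine Fin.lastCases ?_ (fun i => ?_) i
  · rw [up_last]
  · rw [up_castSucc]; rfl

theorem substF_imp {n m : ℕ} (φ ψ : Fml n) (s : Fin n → Tm m) :
    substF (φ ⟹ ψ) s = (substF φ s ⟹ substF ψ s) := rfl

theorem substF_all {n m : ℕ} (φ : Fml (n + 1)) (s : Fin n → Tm m) :
    substF (∀' φ) s = ∀' (substF φ (up s)) := rfl

theorem substF_not {n m : ℕ} (φ : Fml n) (s : Fin n → Tm m) :
    substF (∼φ) s = ∼(substF φ s) := rfl

theorem substF_inf {n m : ℕ} (φ ψ : Fml n) (s : Fin n → Tm m) :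
    substF (φ ⊓ ψ) s = substF φ s ⊓ substF ψ s := rfl

theorem substF_sup {n m : ℕ} (φ ψ : Fml n) (s : Fin n → Tm m) :
    substF (φ ⊔ ψ) s = substF φ s ⊔ substF ψ s := rfl

theorem substF_equal {n m : ℕ} (t u : Tm n) (s : Fin n → Tm m) :
    substF (BoundedFormula.equal t u) s = BoundedFormula.equal (substT t s) (substT u s) := rfl

theorem substF_ltF {n m : ℕ} (t u : Tm n) (s : Fin n → Tm m) :
    substF (ltF t u) s = ltF (substT t s) (substT u s) := by
  refine congrArg (BoundedFormula.rel (L := PRLang) PRRel.lt) (funext fun i => ?_)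
  fin_cases i <;> rfl

theorem substF_ball {n m : ℕ} (t : Tm n) (φ : Fml (n + 1)) (s : Fin n → Tm m) :
    substF (ball t φ) s = ball (substT t s) (substF φ (up s)) := by
  simp only [ball, substF_all, substF_imp, substF_ltF, substT_vr, up_last, substT_liftT_up]

theorem substF_bex {n m : ℕ} (t : Tm n) (φ : Fml (n + 1)) (s : Fin n → Tm m) :
    substF (bex t φ) s = bex (substT t s) (substF φ (up s)) := by
  simp only [bex, BoundedFormula.ex, substF_all, substF_not, substF_inf, substF_ltF, substT_vr,
    up_last, substT_liftT_up]

/-- Collapses iterated lifting and instantiation into one simultaneous substitution, which can then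
be compared entry by entry. The quantifier case is `substT_up_up`. -/
theorem substF_substF {n m k : ℕ} (φ : Fml n) (s : Fin n → Tm m) (r : Fin m → Tm k) :
    substF (substF φ s) r = substF φ fun i => substT (s i) r := by
  induction φ generalizing m k with
  | falsum => rfl
  | equal t u => simp only [substF, substT_substT]
  | rel R ts => simp only [substF, substT_substT]
  | imp φ ψ ih₁ ih₂ => simp only [substF, ih₁, ih₂]
  | all φ ih =>
    refine congrArg BoundedFormula.all ((ih (up s) (up r)).trans ?_)
    rw [substT_up_up]; rfl

theorem substF_id {n : ℕ} (φ : Fml n) : substF φ vr = φ := by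
  induction φ with
  | falsum => rfl
  | equal t u => simp only [substF, substT_id]
  | rel R ts => simp only [substF, substT_id]
  | imp φ ψ ih₁ ih₂ => simp only [substF, ih₁, ih₂]
  | all φ ih => exact congrArg BoundedFormula.all ((congrArg _ up_vr).trans ih)

theorem liftS_zero (σ : PRLang.Sentence) : liftS (n := 0) σ = σ :=
  (congrArg (substF (n := 0) σ) (funext fun i => i.elim0)).trans (substF_id σ)

/-! ### `Δ₀` formulas -/

namespace IsDelta0

theorem not {n : ℕ} {φ : Fml n} (h : IsDelta0 φ) : IsDelta0 (∼φ) := h.imp .falsum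

theorem inf {n : ℕ} {φ ψ : Fml n} (h₁ : IsDelta0 φ) (h₂ : IsDelta0 ψ) : IsDelta0 (φ ⊓ ψ) :=
  (h₁.imp h₂.not).not

theorem sup {n : ℕ} {φ ψ : Fml n} (h₁ : IsDelta0 φ) (h₂ : IsDelta0 ψ) : IsDelta0 (φ ⊔ ψ) :=
  h₁.not.imp h₂

theorem substF {n m : ℕ} {φ : Fml n} (h : IsDelta0 φ) (s : Fin n → Tm m) :
    IsDelta0 (substF φ s) := by
  induction h generalizing m with
  | falsum => exact .falsum
  | equal t u => exact .equal _ _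
  | lt t u => rw [substF_ltF]; exact .lt _ _
  | imp _ _ ih₁ ih₂ => exact (ih₁ s).imp (ih₂ s)
  | ball t _ ih => rw [substF_ball]; exact (ih _).ball _
  | bex t _ ih => rw [substF_bex]; exact (ih _).bex _

theorem kreiselOrder {π₀ : Fml 1} (h : IsDelta0 π₀) : IsDelta0 (kreiselOrder π₀) :=
  ((lt _ _).inf ((h.substF _).ball _)).sup ((lt _ _).inf ((h.substF _).not.bex _))

end IsDelta0

/-! ### The standard model -/

variable (e : Empty → ℕ)

theorem realize_substT {n m : ℕ} (t : Tm n) (s : Fin n → Tm m) (v : Fin m → ℕ) :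
    (substT t s).realize (Sum.elim e v) =
      t.realize (Sum.elim e fun i => (s i).realize (Sum.elim e v)) := by
  rw [substT, Term.realize_subst]
  congr 1
  funext a
  rcases a with a | i <;> [exact a.elim; rfl]

theorem realize_vr {n : ℕ} (i : Fin n) (v : Fin n → ℕ) :
    (vr i).realize (Sum.elim e v) = v i := rfl

theorem realize_liftT {n : ℕ} (t : Tm n) (v : Fin n → ℕ) (a : ℕ) :
    (liftT t).realize (Sum.elim e (Fin.snoc (α := fun _ => ℕ) v a)) =
      t.realize (Sum.elim e v) := by
  simp only [liftT, realize_substT, realize_vr, Fin.snoc_castSucc]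

theorem realize_substF {n m : ℕ} (φ : Fml n) (s : Fin n → Tm m) (v : Fin m → ℕ) :
    (substF φ s).Realize e v ↔ φ.Realize e fun i => (s i).realize (Sum.elim e v) := by
  induction φ generalizing m with
  | falsum => rfl
  | equal t u => simp only [substF, BoundedFormula.Realize, realize_substT]
  | rel R ts => simp only [substF, BoundedFormula.Realize, realize_substT]
  | imp φ ψ ih₁ ih₂ => simp only [substF, BoundedFormula.Realize, ih₁, ih₂]
  | all φ ih =>
    refine forall_congr' fun a => (ih (up s) (Fin.snoc v a)).trans ?_
    refine iff_of_eq (congrArg _ (funext fun i => ?_))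
    refine Fin.lastCases ?_ (fun i => ?_) i
    · simp only [up_last, realize_vr, Fin.snoc_last]
    · simp only [up_castSucc, realize_liftT, Fin.snoc_castSucc]

theorem realize_ltF {n : ℕ} (t u : Tm n) (v : Fin n → ℕ) :
    (ltF t u).Realize e v ↔ t.realize (Sum.elim e v) < u.realize (Sum.elim e v) := Iff.rfl

theorem realize_ball {n : ℕ} (t : Tm n) (φ : Fml (n + 1)) (v : Fin n → ℕ) :
    (ball t φ).Realize e v ↔
      ∀ a < t.realize (Sum.elim e v), φ.Realize e (Fin.snoc v a) := by
  simp only [ball, BoundedFormula.realize_all, BoundedFormula.realize_imp, realize_ltF,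
    realize_vr, realize_liftT, Fin.snoc_last]

theorem realize_bex {n : ℕ} (t : Tm n) (φ : Fml (n + 1)) (v : Fin n → ℕ) :
    (bex t φ).Realize e v ↔
      ∃ a < t.realize (Sum.elim e v), φ.Realize e (Fin.snoc v a) := by
  simp only [bex, BoundedFormula.realize_ex, BoundedFormula.realize_inf, realize_ltF,
    realize_vr, realize_liftT, Fin.snoc_last]

theorem realize_substF_last {n : ℕ} (φ : Fml 1) (v : Fin n → ℕ) (a : ℕ) :
    (substF φ ![vr (Fin.last n)]).Realize default (Fin.snoc v a) ↔ Holds φ a := by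
  rw [realize_substF, Holds]
  refine iff_of_eq (congrArg _ (funext fun i => ?_))
  fin_cases i
  simp [vr]

theorem relOf_kreiselOrder (π₀ : Fml 1) (x y : ℕ) :
    relOf (kreiselOrder π₀) x y ↔
      (x < y ∧ ∀ z < x, Holds π₀ z) ∨ (y < x ∧ ∃ z < y, ¬ Holds π₀ z) := by
  have h (a : ℕ) : (substF π₀ ![vr (2 : Fin 3)]).Realize default (Fin.snoc ![x, y] a) ↔
      Holds π₀ a := realize_substF_last π₀ ![x, y] a
  simp only [relOf, kreiselOrder, BoundedFormula.realize_sup, BoundedFormula.realize_inf,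
    realize_ball, realize_bex, realize_ltF, BoundedFormula.realize_not, h]
  rfl

theorem realize_all_iff_holds (π₀ : Fml 1) :
    ℕ ⊨ (∀' π₀ : PRLang.Sentence) ↔ ∀ x, Holds π₀ x := by
  refine forall_congr' fun a => iff_of_eq
    (congrArg₂ π₀.Realize (Subsingleton.elim _ _) (funext fun i => ?_))
  fin_cases i
  rfl

theorem relOf_kreiselOrder_iff_lt {π₀ : Fml 1} {x y : ℕ} (h : ∀ z < min x y, Holds π₀ z) :
    relOf (kreiselOrder π₀) x y ↔ x < y := by
  rw [relOf_kreiselOrder]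
  constructor
  · rintro (⟨hxy, -⟩ | ⟨hyx, z, hz, hn⟩)
    · exact hxy
    -- In the reversed case `z < y < x`, so the counterexample would lie below `min x y`.
    · exact absurd (h z (lt_min (hz.trans hyx) hz)) hn
  · exact fun hxy => .inl ⟨hxy, fun z hz => h z (lt_min hz (hz.trans hxy))⟩

theorem relOf_kreiselOrder_iff_gt {π₀ : Fml 1} {x y : ℕ} (h : ∃ z < min x y, ¬ Holds π₀ z) :
    relOf (kreiselOrder π₀) x y ↔ y < x := by
  obtain ⟨z, hz, hn⟩ := h
  rw [relOf_kreiselOrder]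
  constructor
  · rintro (⟨-, hall⟩ | ⟨hyx, -⟩)
    · exact absurd (hall z (lt_min_iff.1 hz).1) hn
    · exact hyx
  · exact fun hyx => .inr ⟨hyx, z, (lt_min_iff.1 hz).2, hn⟩

/-- The only place where the truth of `π` enters. -/
theorem relOf_kreiselOrder_eq_lt {π₀ : Fml 1} (h : ∀ x, Holds π₀ x) :
    relOf (kreiselOrder π₀) = (· < ·) :=
  funext fun _ => funext fun _ => propext (relOf_kreiselOrder_iff_lt fun z _ => h z)

/-! ### Derivations -/

namespace Deriv

variable {T : PRLang.Theory} {n : ℕ} {Γ Δ : List (Fml n)} {φ ψ χ : Fml n}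

theorem weaken (h : Deriv T Γ φ) (hs : Γ ⊆ Δ) : Deriv T Δ φ := by
  induction h with
  | ax h => exact .ax h
  | hyp h => exact .hyp (hs h)
  | impI _ ih => exact .impI (ih (List.cons_subset_cons _ hs))
  | impE _ _ ih₁ ih₂ => exact .impE (ih₁ hs) (ih₂ hs)
  | raa _ ih => exact .raa (ih (List.cons_subset_cons _ hs))
  | allI _ ih => exact .allI (ih (List.map_subset _ hs))
  | allE t _ ih => exact .allE t (ih hs)
  | eqI t => exact .eqI t
  | eqE φ _ _ ih₁ ih₂ => exact .eqE φ (ih₁ hs) (ih₂ hs)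

theorem weaken_cons (h : Deriv T Γ φ) : Deriv T (ψ :: Γ) φ :=
  h.weaken (List.subset_cons_self _ _)

theorem falsumE (h : Deriv T Γ BoundedFormula.falsum) : Deriv T Γ φ := .raa h.weaken_cons

theorem andI (h₁ : Deriv T Γ φ) (h₂ : Deriv T Γ ψ) : Deriv T Γ (φ ⊓ ψ) :=
  .impI (.impE (.impE (.hyp (List.mem_cons_self)) h₁.weaken_cons) h₂.weaken_cons)

/-- `φ ⊓ ψ` unfolds to `∼(φ ⟹ ∼ψ)`, and assuming `∼ψ` proves `φ ⟹ ∼ψ`. -/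
theorem andE_right (h : Deriv T Γ (φ ⊓ ψ)) : Deriv T Γ ψ :=
  .raa (.impE h.weaken_cons (.impI (.hyp (.tail _ List.mem_cons_self))))

theorem orI_left (h : Deriv T Γ φ) : Deriv T Γ (φ ⊔ ψ) :=
  .impI (.falsumE (.impE (.hyp (List.mem_cons_self)) h.weaken_cons))

theorem orI_right (h : Deriv T Γ ψ) : Deriv T Γ (φ ⊔ ψ) := .impI h.weaken_cons

end Deriv

/-! ### Kreisel's argument inside `PRA` -/

variable {T : PRLang.Theory} {n : ℕ} {Γ : List (Fml n)}

theorem substT_succT {m : ℕ} (t : Tm n) (s : Fin n → Tm m) :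
    substT (succT t) s = succT (substT t s) := by
  refine congrArg (fn PRFun.succ) (funext fun i => ?_)
  fin_cases i
  rfl

/-- The left side is what results from lifting a closed axiom `∀' ∀' φ` and applying `allE` to `s`,
then to `t`. -/
theorem inst_inst (φ : Fml 2) (s t : Tm n) :
    inst (substF (substF φ (up (up Fin.elim0))) (up (Fin.snoc (α := fun _ => Tm n) vr s))) t =
      substF φ ![s, t] := by
  rw [inst, substF_substF, substF_substF]
  congr 1
  funext i
  fin_cases i
  · change substT (up (up Fin.elim0) (Fin.castSucc (Fin.last 0))) _ = s
    simp only [up_castSucc, up_last, substT_vr, Fin.snoc_last, substT_liftT,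
      Fin.snoc_castSucc, substT_id]
  · change substT (up (up Fin.elim0) (Fin.last 1)) _ = t
    simp only [up_last, substT_vr, Fin.snoc_last]

theorem Deriv.lt_succ (hT : PRA ⊆ T) (s t : Tm n) (h : Deriv T Γ (ltF s t ⊔ .equal s t)) :
    Deriv T Γ (ltF s (succT t)) := by
  have h₀ := Deriv.allE t (.allE s (.ax (Γ := Γ) (hT PRAAxiom.lt_succ)))
  erw [inst_inst] at h₀
  change Deriv T Γ (_ ⊓ (substF (_ ⊔ _) _ ⟹ _)) at h₀
  simp only [substF_sup, substF_ltF, substF_equal, substT_vr, substT_succT] at h₀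
  exact .impE h₀.andE_right h

/-- `∀ z < t, π₀(z)` -/
def allBelow (π₀ : Fml 1) (t : Tm n) : Fml n := ball t (substF π₀ ![vr (Fin.last n)])

theorem substF_kreiselOrder (π₀ : Fml 1) (s t : Tm n) :
    substF (kreiselOrder π₀) ![s, t] =
      (ltF s t ⊓ allBelow π₀ s) ⊔ (ltF t s ⊓ bex t ∼(substF π₀ ![vr (Fin.last n)])) := by
  have h : (fun i => substT (![vr (2 : Fin 3)] i) (up ![s, t])) = ![vr (Fin.last n)] := by
    funext i
    fin_cases i
    exact up_last (n := 2) ![s, t]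
  simp only [kreiselOrder, substF_sup, substF_inf, substF_ltF, substF_ball, substF_bex,
    substF_not, substF_substF, h, substT_vr]
  rfl

theorem substF_allBelow {m : ℕ} (π₀ : Fml 1) (t : Tm n) (s : Fin n → Tm m) :
    substF (allBelow π₀ t) s = allBelow π₀ (substT t s) := by
  rw [allBelow, substF_ball, substF_substF, allBelow]
  congr 2
  funext i
  fin_cases i
  exact up_last s

theorem inst_substF_last (π₀ : Fml 1) (u : Tm n) :
    inst (substF π₀ ![vr (Fin.last n)]) u = substF π₀ ![u] := by
  rw [inst, substF_substF]
  congr 1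
  funext i
  fin_cases i
  exact Fin.snoc_last (α := fun _ => Tm n) u vr

theorem inst_liftT (t u : Tm n) : substT (liftT t) (Fin.snoc (α := fun _ => Tm n) vr u) = t := by
  simp only [substT_liftT, Fin.snoc_castSucc, substT_id]

theorem inst_lt_imp (t u : Tm n) (φ : Fml (n + 1)) :
    inst (ltF (vr (Fin.last n)) (liftT t) ⟹ φ) u = (ltF u t ⟹ inst φ u) := by
  simp only [inst, substF_imp, substF_ltF, inst_liftT, substT_vr, Fin.snoc_last]

theorem Deriv.allBelow_inst {π₀ : Fml 1} {t : Tm n} (h : Deriv T Γ (allBelow π₀ t)) (u : Tm n)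
    (hu : Deriv T Γ (ltF u t)) : Deriv T Γ (substF π₀ ![u]) := by
  have h₀ := Deriv.allE u h
  rw [inst_lt_imp, inst_substF_last] at h₀
  exact .impE h₀ hu

theorem Deriv.allBelow_of_succ {π₀ : Fml 1} (hT : PRA ⊆ T) {t : Tm n}
    (h : Deriv T Γ (allBelow π₀ (succT t))) : Deriv T Γ (allBelow π₀ t) := by
  -- `h` is cut in as an assumption so that `allI` lifts its formula, which avoids lifting a
  -- derivation.
  refine .impE (.impI (.allI (.impI ?_))) h
  refine .allBelow_inst (t := succT (liftT t)) ?_ (vr (Fin.last n))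
    (.lt_succ hT _ _ (.orI_left (.hyp List.mem_cons_self)))
  refine .weaken_cons (.hyp ?_)
  rw [List.map_cons, liftF, substF_allBelow, substT_succT]
  exact List.mem_cons_self

theorem inst_up_last (φ : Fml (n + 1)) :
    inst (substF φ (up fun i => vr i.castSucc)) (vr (Fin.last n)) = φ := by
  rw [inst, substF_substF]
  conv_rhs => rw [← substF_id φ]
  congr 1
  funext i
  refine Fin.lastCases ?_ (fun i => ?_) i
  · rw [up_last, substT_vr, Fin.snoc_last]
  · rw [up_castSucc, inst_liftT]

/-- A counterexample below `t` activates the reversed disjunct of `≺`, and `t < S t`. -/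
theorem Deriv.succ_prec {π₀ : Fml 1} (hT : PRA ⊆ T) {t : Tm n}
    (h : Deriv T Γ ∼(allBelow π₀ t)) :
    Deriv T Γ (substF (kreiselOrder π₀) ![succT t, t]) := by
  rw [substF_kreiselOrder]
  refine .orI_right (.andI (.lt_succ hT _ _ (.orI_right (.eqI t))) ?_)
  -- `bex` is `∼∀∼`: assuming that no `z < t` violates `π₀`, classical reasoning proves `allBelow π₀
  -- t`, against `h`.
  refine .impI (.impE h.weaken_cons (.allI (.impI (.raa ?_))))
  have h₁ := Deriv.allE (T := T) (Γ := ∼(substF π₀ ![vr (Fin.last n)]) ::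
    ltF (vr (Fin.last n)) (liftT t) :: List.map liftF
      ((∀' ∼(ltF (vr (Fin.last n)) (liftT t) ⊓ ∼(substF π₀ ![vr (Fin.last n)]))) :: Γ))
    (vr (Fin.last n)) (.hyp (.tail _ (.tail _ List.mem_cons_self)))
  erw [inst_up_last] at h₁
  exact .impE h₁ (.andI (.hyp (.tail _ List.mem_cons_self)) (.hyp List.mem_cons_self))

/-- `∀ z < x, π₀(z)` is progressive along `≺`. -/
theorem Deriv.progressive (π₀ : Fml 1) (hT : PRA ⊆ T) :
    Deriv T Γ (∀' ((∀' (substF (kreiselOrder π₀) ![vr (Fin.last (n + 1)),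
      vr (Fin.last n).castSucc] ⟹ allBelow π₀ (vr (Fin.last (n + 1))))) ⟹
        allBelow π₀ (vr (Fin.last n)))) := by
  -- Assuming `φ(x)` fails, it suffices to derive `φ(S x)`; the hypothesis of progressiveness is
  -- then used at `S x ≺ x`.
  refine .allI (.impI (.raa (.impE (.hyp List.mem_cons_self) (.allBelow_of_succ hT ?_))))
  have h := Deriv.allE (T := T) (Γ := ∼(allBelow π₀ (vr (Fin.last n))) ::
    (∀' (substF (kreiselOrder π₀) ![vr (Fin.last (n + 1)), vr (Fin.last n).castSucc] ⟹
      allBelow π₀ (vr (Fin.last (n + 1))))) :: List.map liftF Γ)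
    (succT (vr (Fin.last n))) (.hyp (.tail _ List.mem_cons_self))
  have he : (fun i => substT (![vr (Fin.last (n + 1)), vr (Fin.last n).castSucc] i)
      (Fin.snoc (α := fun _ => Tm (n + 1)) vr (succT (vr (Fin.last n))))) =
        ![succT (vr (Fin.last n)), vr (Fin.last n)] := by
    funext i
    fin_cases i
    · exact Fin.snoc_last (α := fun _ => Tm (n + 1)) _ vr
    · exact Fin.snoc_castSucc (α := fun _ => Tm (n + 1)) _ vr _
  rw [inst, substF_imp, substF_substF, he, substF_allBelow, substT_vr, Fin.snoc_last] at h
  exact .impE h (.succ_prec hT (.hyp List.mem_cons_self))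

theorem proves_all_of_TI {π₀ : Fml 1} (hπ₀ : IsDelta0 π₀) :
    Proves (PRA ∪ TI (kreiselOrder π₀)) (∀' π₀ : PRLang.Sentence) := by
  have hT : PRA ⊆ PRA ∪ TI (kreiselOrder π₀) := Set.subset_union_left
  have h : Deriv (PRA ∪ TI (kreiselOrder π₀)) (n := 0) [] _ :=
    .ax (.inr ⟨0, allBelow π₀ (vr (Fin.last 0)), (hπ₀.substF _).ball _, rfl⟩)
  rw [liftS_zero, tiAxiom, substF_allBelow, substT_vr, Fin.snoc_last] at h
  have h₁ : Deriv (PRA ∪ TI (kreiselOrder π₀)) (n := 0) []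
      (∀' (allBelow π₀ (vr (Fin.last 0)))) := .impE h (.progressive π₀ hT)
  refine .impE (.impI (.allI ?_)) h₁
  -- The instance at `S x` is needed, since `∀ z < x, π₀(z)` does not cover `x` itself.
  have h₂ := Deriv.allE (T := PRA ∪ TI (kreiselOrder π₀)) (Γ := List.map liftF
    [(∀' (allBelow π₀ (vr (Fin.last 0))) : Fml 0)]) (succT (vr (Fin.last 0)))
    (.hyp List.mem_cons_self)
  erw [inst, substF_allBelow, substF_allBelow, substT_vr, Fin.snoc_last] at h₂
  have h₃ := h₂.allBelow_inst (vr (Fin.last 0)) (.lt_succ hT _ _ (.orI_right (.eqI _)))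
  have he : (![vr (Fin.last 0)] : Fin 1 → Tm 1) = vr := by
    funext i
    fin_cases i
    rfl
  rwa [he, substF_id] at h₃

end Kreisel

theorem mainTheorem3 (π₀ : Kreisel.Fml 1) (hπ₀ : Kreisel.IsDelta0 π₀) :
    (∀ x y : ℕ, (∀ z < min x y, Kreisel.Holds π₀ z) →
      (Kreisel.relOf (Kreisel.kreiselOrder π₀) x y ↔ x < y)) ∧
    (∀ x y : ℕ, (∃ z < min x y, ¬ Kreisel.Holds π₀ z) →
      (Kreisel.relOf (Kreisel.kreiselOrder π₀) x y ↔ y < x)) ∧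
    (ℕ ⊨ (∀' π₀ : Kreisel.PRLang.Sentence) →
      Kreisel.IsDelta0 (Kreisel.kreiselOrder π₀) ∧
      PrimrecRel (Kreisel.relOf (Kreisel.kreiselOrder π₀)) ∧
      (∃ _ : IsWellOrder ℕ (Kreisel.relOf (Kreisel.kreiselOrder π₀)),
        Ordinal.type (Kreisel.relOf (Kreisel.kreiselOrder π₀)) = Ordinal.omega0) ∧
      Kreisel.Proves (Kreisel.PRA ∪ Kreisel.TI (Kreisel.kreiselOrder π₀))
        (∀' π₀ : Kreisel.PRLang.Sentence)) := by
  refine ⟨fun _ _ => Kreisel.relOf_kreiselOrder_iff_lt,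
    fun _ _ => Kreisel.relOf_kreiselOrder_iff_gt, fun h => ?_⟩
  -- This replaces the relation on `ℕ` only; the `Δ₀` and provability claims still concern the
  -- formula.
  rw [Kreisel.relOf_kreiselOrder_eq_lt ((Kreisel.realize_all_iff_holds π₀).1 h)]
  exact ⟨hπ₀.kreiselOrder, Primrec.nat_lt, ⟨inferInstance, Ordinal.type_nat_lt⟩,
    Kreisel.proves_all_of_TI hπ₀⟩
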